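/- Let $\mathrm{Conv}(\mathbb R^n)$ be the set of all convex, lower semicontinuous functions $u\colon\mathbb R^n\to\mathbb R\cup\{+\infty\}$ with $u\not\equiv+\infty$, equipped with the topology associated to epi-convergence: $u_k$ epi-converges to $u$ if for every $x\in\mathbb R^n$ one has $u(x)\le\liminf_{k\to\infty} u_k(x_k)$ for every sequence $x_k\to x$, and $u(x)=\lim_{k\to\infty}u_k(x_k)$ for some sequence $x_k\to x$. Let $\vee$ and $\wedge$ denote pointwise maximum and minimum. Let $Z\colon\mathrm{Conv}(\mathbb R^n)\to\mathbb R$ be a continuous valuation, that is, $Z$ is continuous and $Z(u\vee v)+Z(u\wedge v)=Z(u)+Z(v)$ for all $u,v\in\mathrm{Conv}(\mathbb R^n)$ with $u\vee v,\,u\wedge v\in\mathrm{Conv}(\mathbb R^n)$. Let $\bigwedge\mathrm{Conv}(\mathbb R^n)$ be the lattice, under $\vee$ and $\wedge$, that consists of all minima of finitely many (at least one) functions from $\mathrm{Conv}(\mathbb R^n)$ and of the function $\equiv+\infty$. (a) There is exactly one function $\bar Z\colon\bigwedge\mathrm{Conv}(\mathbb R^n)\to\mathbb R$ such that $\bar Z(u)=Z(u)$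 for all $u\in\mathrm{Conv}(\mathbb R^n)$, $\bar Z(+\infty)=0$, and $\bar Z(f\vee g)+\bar Z(f\wedge g)=\bar Z(f)+\bar Z(g)$ for all $f,g\in\bigwedge\mathrm{Conv}(\mathbb R^n)$. (b) For all $m\ge1$ and $u_1,\dots,u_m\in\mathrm{Conv}(\mathbb R^n)$ with $u_1\wedge\dots\wedge u_m\in\mathrm{Conv}(\mathbb R^n)$, $$Z(u_1\wedge\dots\wedge u_m)=\sum_{\emptyset\ne J\subset\{1,\dots,m\}}(-1)^{|J|-1}Z(u_J),\qquad u_J=\bigvee_{j\in J}u_j,$$ where $Z(u_J)$ is read as $0$ if $u_J\equiv+\infty$. -/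

import Mathlib

open Filter Topology

/-- A function `u : ℝⁿ → (-∞, +∞]` that is convex (its epigraph is a convex set), lower
semicontinuous and not identically `+∞`. -/
def IsConv {n : ℕ} (u : EuclideanSpace ℝ (Fin n) → EReal) : Prop :=
  (∀ x, u x ≠ ⊥) ∧
  Convex ℝ {p : EuclideanSpace ℝ (Fin n) × ℝ | u p.1 ≤ (p.2 : EReal)} ∧
  LowerSemicontinuous u ∧
  ∃ x, u x ≠ ⊤

/-- The space `Conv(ℝⁿ)`. It is a structure, so that it does not inherit the topology of
pointwise convergence. -/
structure Conv (n : ℕ) where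
  toFun : EuclideanSpace ℝ (Fin n) → EReal
  isConv : IsConv toFun

/-- Epi-convergence of a sequence in `Conv(ℝⁿ)`. -/
def EpiConverges {n : ℕ} (u : ℕ → Conv n) (v : Conv n) : Prop :=
  ∀ x : EuclideanSpace ℝ (Fin n),
    (∀ y : ℕ → EuclideanSpace ℝ (Fin n), Tendsto y atTop (𝓝 x) →
      v.toFun x ≤ liminf (fun k => (u k).toFun (y k)) atTop) ∧
    ∃ y : ℕ → EuclideanSpace ℝ (Fin n), Tendsto y atTop (𝓝 x) ∧
      Tendsto (fun k => (u k).toFun (y k)) atTop (𝓝 (v.toFun x))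

/-- The topology associated to epi-convergence: `U` is open if every sequence that epi-converges
to a point of `U` is eventually in `U`. Continuity of a map into a topological space is therefore
the same as sequential continuity along epi-convergent sequences. -/
instance Conv.instTopologicalSpace (n : ℕ) : TopologicalSpace (Conv n) where
  IsOpen U := ∀ (u : ℕ → Conv n) (v : Conv n), EpiConverges u v → v ∈ U → ∀ᶠ k in atTop, u k ∈ U
  isOpen_univ := fun _ _ _ _ => Eventually.of_forall fun _ => trivial
  isOpen_inter := fun _ _ hs ht u v h hv => (hs u v h hv.1).and (ht u v h hv.2)
  isOpen_sUnion := by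
    rintro S hS u v h ⟨U, hU, hv⟩
    exact (hS U hU u v h hv).mono fun k hk => ⟨U, hU, hk⟩

/-- `Z` is a valuation on `Conv(ℝⁿ)`: `Z(u ∨ v) + Z(u ∧ v) = Z(u) + Z(v)` whenever the pointwise
maximum `u ∨ v` and the pointwise minimum `u ∧ v` both belong to `Conv(ℝⁿ)`. -/
def IsConvValuation {n : ℕ} (Z : Conv n → ℝ) : Prop :=
  ∀ u v p q : Conv n, p.toFun = u.toFun ⊔ v.toFun → q.toFun = u.toFun ⊓ v.toFun →
    Z p + Z q = Z u + Z v

lemma supClosed_insert_top_isConv (n : ℕ) :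
    SupClosed (insert ⊤ {u : EuclideanSpace ℝ (Fin n) → EReal | IsConv u}) := by
  rintro u (rfl | hu) v (rfl | hv)
  · simp
  · simp
  · simp
  · by_cases h : u ⊔ v = ⊤
    · exact Or.inl h
    · refine Or.inr ⟨fun x hx => hu.1 x (le_bot_iff.1 (hx ▸ le_sup_left)), ?_,
        hu.2.2.1.sup hv.2.2.1, ?_⟩
      · have := hu.2.1.inter hv.2.1
        convert this using 1
        ext p
        simp
      · by_contra! hx
        exact h (funext hx)

/-- The lattice `⋀ Conv(ℝⁿ)` of all minima of finite nonempty families in `Conv(ℝⁿ)`, with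
pointwise minimum and maximum, together with the function `⊤ ≡ +∞`. The latter has to be
included since it is the maximum of two functions of `Conv(ℝⁿ)` with disjoint domains; its
epigraph is the empty set. -/
noncomputable def minLattice (n : ℕ) : Sublattice (EuclideanSpace ℝ (Fin n) → EReal) where
  carrier := insert ⊤ (infClosure {u | IsConv u})
  supClosed' := by
    have key : insert ⊤ (infClosure {u : EuclideanSpace ℝ (Fin n) → EReal | IsConv u}) =
        infClosure (insert ⊤ {u | IsConv u}) := by
      apply Set.Subset.antisymm
      · exact Set.insert_subset (subset_infClosure (Set.mem_insert _ _))
          (infClosure_mono (Set.subset_insert _ _))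
      · refine infClosure_min (Set.insert_subset_insert subset_infClosure) ?_
        rintro u (rfl | hu) v (rfl | hv)
        · simp
        · simpa using Or.inr hv
        · simpa using Or.inr hu
        · exact Or.inr (infClosed_infClosure hu hv)
    rw [key]
    exact (supClosed_insert_top_isConv n).infClosure
  infClosed' := by
    rintro u (rfl | hu) v (rfl | hv)
    · simp
    · simpa using Or.inr hv
    · simpa using Or.inr hu
    · exact Or.inr (infClosed_infClosure hu hv)

/-- The inclusion of `Conv(ℝⁿ)` in the lattice of finite minima. -/
noncomputable def Conv.toMinLattice {n : ℕ} (u : Conv n) : minLattice n :=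
  ⟨u.toFun, Or.inr (subset_infClosure u.isConv)⟩

/-- The function `≡ +∞` as an element of the lattice. -/
noncomputable def minLatticeTop (n : ℕ) : minLattice n := ⟨⊤, Or.inl rfl⟩

/-- A valuation on the lattice of finite minima, with the usual normalization that the value at
`≡ +∞` (the function with empty epigraph) is zero. -/
def IsMinLatticeValuation {n : ℕ} (Y : minLattice n → ℝ) : Prop :=
  Y (minLatticeTop n) = 0 ∧ ∀ f g : minLattice n, Y (f ⊔ g) + Y (f ⊓ g) = Y f + Y g

open Classical in
/-- The value of `Z` at `f`, with value `0` if `f` is not in `Conv(ℝⁿ)`. It is used for maxima of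
functions in `Conv(ℝⁿ)`, which belong to `Conv(ℝⁿ)` unless they are `≡ +∞`. -/
noncomputable def valueOrZero {n : ℕ} (Z : Conv n → ℝ)
    (f : EuclideanSpace ℝ (Fin n) → EReal) : ℝ :=
  if h : IsConv f then Z ⟨f, h⟩ else 0

/-! Identify a function with the indicator of its epigraph: `⊔` becomes intersection and `⊓` becomes
union. If `Z` respects every linear relation among the indicators of convex epigraphs, it extends to
a linear functional Φ on functions (`exists_linearMap_epiIndicator`). Then f ↦ Φ(1_{epi f}) is the
extension, and (b) is Φ applied to inclusion–exclusion for indicators. Uniqueness follows by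
induction on the number of functions in a minimum, using distributivity.

The core is `sum_mul_cutBelow_eq_zero`, by induction on the number of terms in a relation. If an
affine `a` lies below one member, that member disappears from the relation on the region strictly
below `a`. The shorter relation shows that replacing each member by its join with `a` does not
change the sum. Exhausting the member by affine minorants and passing to the limit allows joining
with the member itself, and finally with the maximum of all members. What remains is the sum of the
coefficients times one value. If that sum is nonzero, the maximum has no epigraph point below the
cutting affine functions; a separation argument then puts a convex combination of them below it, and
the value vanishes.

The limit step needs continuity along increasing sequences even when the supremum is `⊤`.
Compactness gives this for truncated functions; the truncation level is then sent to infinity. -/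

/-! ### Closed convex functions. -/

/-- A convex lower semicontinuous function with values in `(-∞, +∞]`, possibly `≡ +∞`. -/
structure IsClosedConvex {E : Type*} [TopologicalSpace E] [AddCommMonoid E] [Module ℝ E]
    (u : E → EReal) : Prop where
  ne_bot : ∀ x, u x ≠ ⊥
  convex : Convex ℝ {p : E × ℝ | u p.1 ≤ (p.2 : EReal)}
  lsc : LowerSemicontinuous u

namespace IsClosedConvex

section Basic

variable {E : Type*} [TopologicalSpace E] [AddCommMonoid E] [Module ℝ E] {u v : E → EReal}

lemma top : IsClosedConvex (⊤ : E → EReal) where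
  ne_bot := by simp
  convex := by
    have : {p : E × ℝ | (⊤ : E → EReal) p.1 ≤ (p.2 : EReal)} = ∅ := by ext; simp
    rw [this]; exact convex_empty
  lsc := lowerSemicontinuous_const

lemma sup (hu : IsClosedConvex u) (hv : IsClosedConvex v) : IsClosedConvex (u ⊔ v) where
  ne_bot x hx := hu.ne_bot x (le_bot_iff.1 (hx ▸ le_sup_left))
  convex := by
    convert hu.convex.inter hv.convex using 1
    ext p
    simp
  lsc := hu.lsc.sup hv.lsc

lemma iSup {ι : Type*} [Nonempty ι] {u : ι → E → EReal} (hu : ∀ i, IsClosedConvex (u i)) :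
    IsClosedConvex (⨆ i, u i) where
  ne_bot x hx := by
    obtain ⟨i⟩ := ‹Nonempty ι›
    refine (hu i).ne_bot x (le_bot_iff.1 ?_)
    rw [← hx, iSup_apply]
    exact le_iSup (fun i => u i x) i
  convex := by
    convert convex_iInter fun i => (hu i).convex using 1
    ext p
    simp
  lsc := by
    convert lowerSemicontinuous_iSup fun i => (hu i).lsc using 1
    ext x
    simp

lemma finset_sup {ι : Type*} {u : ι → E → EReal} (hu : ∀ i, IsClosedConvex (u i)) {s : Finset ι}
    (hs : s.Nonempty) : IsClosedConvex (s.sup u) := by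
  rw [← Finset.sup'_eq_sup hs]
  exact Finset.sup'_induction hs u (fun _ h _ h' => h.sup h') fun i _ => hu i

lemma isClosed_epigraph (hu : IsClosedConvex u) :
    IsClosed {p : E × ℝ | u p.1 ≤ (p.2 : EReal)} :=
  (lowerSemicontinuous_iff_isClosed_epigraph.1 hu.lsc).preimage
    (continuous_fst.prodMk (continuous_coe_real_ereal.comp continuous_snd))

end Basic

end IsClosedConvex

lemma EReal.le_of_forall_le_coe {a b : EReal} (hb : b ≠ ⊥)
    (h : ∀ t : ℝ, b ≤ t → a ≤ t) : a ≤ b := by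
  induction b with
  | bot => exact absurd rfl hb
  | top => exact le_top
  | coe r => exact h r le_rfl

/-! ### Affine minorants and separation. -/

section Affine

variable {E : Type*} [NormedAddCommGroup E] [NormedSpace ℝ E]

/-- The affine function `x ↦ a.1 x + a.2`. -/
def affineFun (a : (E →L[ℝ] ℝ) × ℝ) (x : E) : EReal := ((a.1 x + a.2 : ℝ) : EReal)

lemma isClosedConvex_affineFun (a : (E →L[ℝ] ℝ) × ℝ) : IsClosedConvex (affineFun a) where
  ne_bot x := EReal.coe_ne_bot _
  convex := by
    intro p hp q hq r s hr hs hrs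
    simp only [affineFun, Set.mem_ofPred_eq, EReal.coe_le_coe_iff, Prod.fst_add, Prod.snd_add,
      Prod.smul_fst, Prod.smul_snd, map_add, map_smul, smul_eq_mul] at *
    have h1 := mul_le_mul_of_nonneg_left hp hr
    have h2 := mul_le_mul_of_nonneg_left hq hs
    have h3 : a.2 = r * a.2 + s * a.2 := by rw [← add_mul, hrs, one_mul]
    linarith
  lsc := by
    apply Continuous.lowerSemicontinuous
    exact continuous_coe_real_ereal.comp (by fun_prop)

/-- A pointwise lower bound for the values of an affine combination. -/
lemma affineFun_inf_le_of_mem_segment {a b c : (E →L[ℝ] ℝ) × ℝ} (hc : c ∈ segment ℝ a b) :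
    affineFun a ⊓ affineFun b ≤ affineFun c := by
  obtain ⟨r, s, hr, hs, hrs, rfl⟩ := hc
  intro x
  simp only [affineFun, Pi.inf_apply, inf_le_iff, EReal.coe_le_coe_iff, Prod.fst_add,
    Prod.snd_add, Prod.smul_fst, Prod.smul_snd, add_apply, smul_apply,
    smul_eq_mul]
  by_contra! h
  have h4 : r = 1 - s := by linarith
  subst h4
  rcases le_total (a.1 x + a.2) (b.1 x + b.2) with h3 | h3
  · nlinarith [mul_nonneg hs (sub_nonneg.2 h3)]
  · nlinarith [mul_nonneg hr (sub_nonneg.2 h3)]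

namespace IsClosedConvex

variable {u : E → EReal}

/-- Separation of a point below the graph from the epigraph by a hyperplane. -/
lemma exists_separation (hu : IsClosedConvex u) {x : E} {t : ℝ} (h : (t : EReal) < u x) :
    ∃ (g : E →L[ℝ] ℝ) (b c : ℝ), g x + b * t < c ∧
      ∀ y (s : ℝ), u y ≤ s → c < g y + b * s := by
  obtain ⟨f, c, hf, hc⟩ := geometric_hahn_banach_point_closed hu.convex hu.isClosed_epigraph
    (x := (x, t)) (by simpa using h)
  have key : ∀ y (s : ℝ), f (y, s) = f.comp (.inl ℝ E ℝ) y + f (0, 1) * s := by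
    intro y s
    have : ((y, s) : E × ℝ) = (y, 0) + s • (0, 1) := by simp
    rw [this, map_add, map_smul, smul_eq_mul, mul_comm s]
    simp
  refine ⟨f.comp (.inl ℝ E ℝ), f (0, 1), c, by rw [← key]; exact hf, fun y s hs => ?_⟩
  rw [← key]
  exact hc (y, s) hs

/-- A hyperplane with `b > 0` is not vertical: dividing by `b` makes it the graph of an affine
function. -/
lemma exists_affineFun_le_of_pos (hu : IsClosedConvex u) {x : E} {t : ℝ} {g : E →L[ℝ] ℝ}
    {b c : ℝ} (hb : 0 < b) (hx : g x + b * t < c)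
    (hc : ∀ y (s : ℝ), u y ≤ s → c < g y + b * s) :
    ∃ a, affineFun a ≤ u ∧ (t : EReal) < affineFun a x := by
  refine ⟨(-(b⁻¹ • g), b⁻¹ * c), fun y => ?_, ?_⟩
  · refine EReal.le_of_forall_le_coe (hu.ne_bot y) fun s hs => ?_
    have := hc y s hs
    simp only [affineFun, EReal.coe_le_coe_iff, neg_apply,
      smul_apply, smul_eq_mul]
    have h2 : b⁻¹ * c < b⁻¹ * (g y + b * s) := mul_lt_mul_of_pos_left this (inv_pos.2 hb)
    have h3 : b⁻¹ * (g y + b * s) = b⁻¹ * g y + s := by field_simp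
    linarith
  · simp only [affineFun, EReal.coe_lt_coe_iff, neg_apply,
      smul_apply, smul_eq_mul]
    have h2 : b⁻¹ * (g x + b * t) < b⁻¹ * c := mul_lt_mul_of_pos_left hx (inv_pos.2 hb)
    have h3 : b⁻¹ * (g x + b * t) = b⁻¹ * g x + t := by field_simp
    linarith

/-- A closed convex function is the pointwise supremum of its affine minorants. -/
lemma exists_affineFun_le (hu : IsClosedConvex u) {x : E} {t : ℝ} (h : (t : EReal) < u x) :
    ∃ a, affineFun a ≤ u ∧ (t : EReal) < affineFun a x := by
  by_cases htop : u = ⊤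
  · refine ⟨(0, t + 1), by simp [htop], ?_⟩
    simp [affineFun, -EReal.coe_add]
  obtain ⟨z, hz⟩ : ∃ z, u z ≠ ⊤ := by
    by_contra! hx
    exact htop (funext hx)
  lift u z to ℝ using ⟨hz, hu.ne_bot z⟩ with r hr
  -- The epigraph contains an upward ray over `z`, so a functional bounded below on it has `b ≥ 0`.
  have nonneg : ∀ {g : E →L[ℝ] ℝ} {b c : ℝ}, (∀ y (s : ℝ), u y ≤ s → c < g y + b * s) →
      0 ≤ b := by
    intro g b c hc
    by_contra! hb
    have h1 := hc z (max r ((c - g z) / b)) (by rw [← hr]; exact_mod_cast le_max_left _ _)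
    have h2 := mul_le_mul_of_nonpos_left (le_max_right r ((c - g z) / b)) hb.le
    rw [mul_div_cancel₀ _ hb.ne] at h2
    linarith
  obtain ⟨a₀, ha₀, -⟩ : ∃ a, affineFun a ≤ u ∧ ((r - 1 : ℝ) : EReal) < affineFun a z := by
    obtain ⟨g, b, c, hx, hc⟩ := hu.exists_separation (x := z) (t := r - 1)
      (by rw [← hr]; exact_mod_cast sub_one_lt r)
    refine hu.exists_affineFun_le_of_pos ((nonneg hc).lt_of_ne ?_) hx hc
    rintro rfl
    have := hc z r hr.ge
    linarith
  obtain ⟨g, b, c, hx, hc⟩ := hu.exists_separation h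
  rcases (nonneg hc).eq_or_lt with rfl | hb
  -- Vertical hyperplane: `c - g` is negative where `u` is finite and positive at `x`, so adding a
  -- large multiple to `a₀` keeps a minorant and exceeds `t` at `x`.
  · simp only [zero_mul, add_zero] at hx hc
    have hd : 0 < c - g x := sub_pos.2 hx
    obtain ⟨k, hk0, hk⟩ : ∃ k : ℝ, 0 ≤ k ∧ t < a₀.1 x + a₀.2 + k * (c - g x) := by
      refine ⟨max 0 ((t - (a₀.1 x + a₀.2) + 1) / (c - g x)), le_max_left _ _, ?_⟩
      have := mul_le_mul_of_nonneg_right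
        (le_max_right 0 ((t - (a₀.1 x + a₀.2) + 1) / (c - g x))) hd.le
      rw [div_mul_cancel₀ _ hd.ne'] at this
      linarith
    refine ⟨a₀ + k • (-g, c), fun y => ?_, ?_⟩
    · refine EReal.le_of_forall_le_coe (hu.ne_bot y) fun s hs => ?_
      have h1 := (ha₀ y).trans hs
      have h2 := mul_nonneg hk0 (sub_nonneg.2 (hc y s hs).le)
      simp only [affineFun, EReal.coe_le_coe_iff, Prod.fst_add, Prod.snd_add, Prod.smul_fst,
        Prod.smul_snd, add_apply, smul_apply,
        neg_apply, smul_eq_mul] at *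
      linarith
    · simp only [affineFun, EReal.coe_lt_coe_iff, Prod.fst_add, Prod.snd_add, Prod.smul_fst,
        Prod.smul_snd, add_apply, smul_apply,
        neg_apply, smul_eq_mul]
      linarith
  · exact hu.exists_affineFun_le_of_pos hb hx hc

/-- A closed convex function is the supremum of a sequence of affine functions. -/
lemma exists_seq_affineFun [SecondCountableTopology E] (hu : IsClosedConvex u) :
    ∃ a : ℕ → (E →L[ℝ] ℝ) × ℝ, ⨆ j, affineFun (a j) = u := by
  let S := {a : (E →L[ℝ] ℝ) × ℝ // affineFun a ≤ u}
  let O : S → Set (E × ℝ) := fun a => {p | (p.2 : EReal) < affineFun a.1 p.1}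
  have hO : ∀ a, IsOpen (O a) := by
    intro a
    have : O a = {p | p.2 < a.1.1 p.1 + a.1.2} := by
      ext p; simp [O, affineFun, -EReal.coe_add]
    rw [this]
    exact isOpen_lt continuous_snd (by fun_prop)
  -- The open strict hypographs of the minorants cover the region strictly below the graph; by the
  -- Lindelöf property countably many suffice.
  obtain ⟨T, hT, hTO⟩ := TopologicalSpace.isOpen_iUnion_countable O hO
  obtain ⟨a₀⟩ : Nonempty S := by
    have h0 := hu.ne_bot 0
    obtain ⟨t, ht, ht'⟩ := EReal.lt_iff_exists_real_btwn.1 (bot_lt_iff_ne_bot.2 h0)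
    obtain ⟨a, ha, -⟩ := hu.exists_affineFun_le ht'
    exact ⟨⟨a, ha⟩⟩
  obtain ⟨e, he⟩ := (hT.insert a₀).exists_eq_range (Set.insert_nonempty _ _)
  refine ⟨fun j => (e j).1, le_antisymm (iSup_le fun j => (e j).2) fun x => ?_⟩
  by_contra! hlt
  obtain ⟨t, ht, ht'⟩ := EReal.lt_iff_exists_real_btwn.1 hlt
  obtain ⟨a, ha, hat⟩ := hu.exists_affineFun_le ht'
  have : (x, t) ∈ ⋃ i, O i := Set.mem_iUnion.2 ⟨⟨a, ha⟩, hat⟩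
  rw [← hTO] at this
  obtain ⟨b, hb, hbt⟩ := Set.mem_iUnion₂.1 this
  obtain ⟨j, rfl⟩ : b ∈ Set.range e := he ▸ Set.mem_insert_of_mem _ hb
  refine lt_irrefl _ (ht.trans (lt_of_lt_of_le hbt ?_))
  rw [iSup_apply]
  exact le_iSup (fun j => affineFun (e j).1 x) j

/-- A convex function above the minimum of finitely many affine functions is above one of their
convex combinations. -/
lemma exists_mem_convexHull_affineFun_le (hu : IsClosedConvex u) (htop : u ≠ ⊤)
    {s : Set ((E →L[ℝ] ℝ) × ℝ)} (hs : s.Finite)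
    (h : ∀ x (t : ℝ), u x ≤ t → ∃ a ∈ s, affineFun a x ≤ t) :
    ∃ b ∈ convexHull ℝ s, affineFun b ≤ u := by
  classical
  have := hs.fintype
  obtain ⟨z, hz⟩ : ∃ z, u z ≠ ⊤ := by
    by_contra! hx
    exact htop (funext hx)
  obtain ⟨r, hr⟩ : ∃ r : ℝ, u z ≤ r := ⟨_, EReal.le_coe_toReal hz⟩
  -- By `h`, this convex set misses the open negative orthant. The coefficients of a separating
  -- functional, once normalized, are the weights of the convex combination.
  let S : Set (s → ℝ) := {q | ∃ x, ∃ t : ℝ, u x ≤ t ∧ ∀ a : s, t - (a.1.1 x + a.1.2) ≤ q a}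
  have hSc : Convex ℝ S := by
    rintro p ⟨x, t, hxt, hp⟩ q ⟨y, t', hyt, hq⟩ α β hα hβ hαβ
    refine ⟨α • x + β • y, α • t + β • t', hu.convex (x := (x, t)) hxt (y := (y, t')) hyt hα hβ hαβ,
      fun a => ?_⟩
    have h1 := mul_le_mul_of_nonneg_left (hp a) hα
    have h2 := mul_le_mul_of_nonneg_left (hq a) hβ
    have h3 : a.1.2 = α * a.1.2 + β * a.1.2 := by rw [← add_mul, hαβ, one_mul]
    simp only [map_add, map_smul, smul_eq_mul, Pi.add_apply, Pi.smul_apply]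
    linarith
  let N : Set (s → ℝ) := Set.univ.pi fun _ => Set.Iio 0
  have hN : ∀ ε : ℝ, 0 < ε → (fun _ => -ε) ∈ N := fun ε hε => by simp [N, hε]
  obtain ⟨f, c, hfN, hfS⟩ := geometric_hahn_banach_open (s := N) (t := S)
    (convex_pi fun _ _ => convex_Iio 0) (isOpen_set_pi Set.finite_univ fun _ _ => isOpen_Iio) hSc
    (by
      rw [Set.disjoint_left]
      rintro q hq ⟨x, t, hxt, hq'⟩
      obtain ⟨a, ha, hat⟩ := h x t hxt
      simp only [affineFun, EReal.coe_le_coe_iff] at hat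
      have h1 := hq' ⟨a, ha⟩
      have h2 : q ⟨a, ha⟩ < 0 := hq _ trivial
      linarith)
  have hc : 0 ≤ c := by
    have hlim : Tendsto (fun ε : ℝ => f (fun _ => -ε)) (𝓝[>] 0) (𝓝 0) := by
      have : Continuous fun ε : ℝ => f (fun _ : s => -ε) := by fun_prop
      have := this.tendsto 0
      simp only [neg_zero] at this
      rw [show (fun _ : s => (0 : ℝ)) = 0 from rfl, map_zero] at this
      exact this.mono_left nhdsWithin_le_nhds
    exact le_of_tendsto hlim (eventually_mem_nhdsWithin.mono fun ε hε => (hfN _ (hN ε hε)).le)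
  let w : s → ℝ := fun a => f (Pi.single a 1)
  have hfw : ∀ q, f q = ∑ a, w a * q a := by
    intro q
    conv_lhs => rw [← Finset.univ_sum_single q]
    rw [map_sum]
    refine Finset.sum_congr rfl fun a _ => ?_
    rw [show Pi.single a (q a) = q a • (Pi.single a 1 : s → ℝ) by
      rw [← Pi.single_smul, smul_eq_mul, mul_one], map_smul, smul_eq_mul, mul_comm]
  let q₀ : s → ℝ := fun a => r - (a.1.1 z + a.1.2)
  have hw : ∀ a, 0 ≤ w a := by
    intro a
    by_contra! hneg
    have hmem : ∀ k : ℝ, 0 ≤ k → q₀ + k • Pi.single a 1 ∈ S := fun k hk => by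
      refine ⟨z, r, hr, fun b => ?_⟩
      have : 0 ≤ (Pi.single a (1 : ℝ) : s → ℝ) b := by
        rw [Pi.single_apply]; split_ifs <;> simp
      simp only [q₀, Pi.add_apply, Pi.smul_apply, smul_eq_mul]
      linarith [mul_nonneg hk this]
    have hq0 := hfS q₀ (by simpa using hmem 0 le_rfl)
    -- The multiple is chosen so that `f` takes the value -1, against `0 ≤ c`.
    have h1 := hfS _ (hmem ((f q₀ + 1) / (-w a)) (div_nonneg (by linarith) (by linarith)))
    rw [map_add, map_smul, smul_eq_mul] at h1
    have h2 : (f q₀ + 1) / (-w a) * w a = -(f q₀ + 1) := by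
      rw [div_mul_eq_mul_div, div_neg, mul_div_cancel_right₀ _ hneg.ne]
    change c ≤ f q₀ + (f q₀ + 1) / (-w a) * w a at h1
    linarith
  have hpos : 0 < ∑ a, w a := by
    refine (Finset.sum_nonneg fun a _ => hw a).lt_of_ne fun h0 => ?_
    have h1 := hfN _ (hN 1 one_pos)
    have h2 := hfS q₀ ⟨z, r, hr, fun _ => le_rfl⟩
    have h3 : ∀ a, w a = 0 := fun a =>
      (Finset.sum_eq_zero_iff_of_nonneg fun a _ => hw a).1 h0.symm a (Finset.mem_univ a)
    simp only [hfw, h3, zero_mul, Finset.sum_const_zero] at h1 h2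
    linarith
  refine ⟨Finset.univ.centerMass w fun a : s => a.1,
    Finset.centerMass_mem_convexHull _ (fun a _ => hw a) hpos fun a _ => a.2, fun x => ?_⟩
  refine EReal.le_of_forall_le_coe (hu.ne_bot x) fun t ht => ?_
  have h1 := hc.trans (hfS _ ⟨x, t, ht, fun _ => le_rfl⟩)
  rw [hfw] at h1
  simp only [mul_sub, Finset.sum_sub_distrib, ← Finset.sum_mul] at h1
  simp only [affineFun, EReal.coe_le_coe_iff, Finset.centerMass, Prod.smul_fst, Prod.smul_snd,
    Prod.fst_sum, Prod.snd_sum, smul_apply, sum_apply,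
    smul_eq_mul, ← mul_add, ← Finset.sum_add_distrib]
  rw [inv_mul_le_iff₀ hpos]
  linarith

end IsClosedConvex

end Affine

/-! ### Indicators of epigraphs. -/

section EpiIndicator

variable {E : Type*}

open Classical in
/-- The indicator function of the epigraph. -/
noncomputable def epiIndicator (u : E → EReal) (p : E × ℝ) : ℝ :=
  if u p.1 ≤ (p.2 : EReal) then 1 else 0

lemma epiIndicator_sup (u v : E → EReal) (p : E × ℝ) :
    epiIndicator (u ⊔ v) p = epiIndicator u p * epiIndicator v p := by
  simp only [epiIndicator, Pi.sup_apply, sup_le_iff]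
  split_ifs <;> simp_all

lemma epiIndicator_sup_add_inf (u v : E → EReal) (p : E × ℝ) :
    epiIndicator (u ⊔ v) p + epiIndicator (u ⊓ v) p = epiIndicator u p + epiIndicator v p := by
  simp only [epiIndicator, Pi.sup_apply, Pi.inf_apply, sup_le_iff, inf_le_iff]
  split_ifs <;> simp_all

end EpiIndicator

/-! ### Linear relations under monotonically continuous valuations. -/

section Valuation

variable {E : Type*} [NormedAddCommGroup E] [NormedSpace ℝ E]

/-- Valuations on the closed convex functions, including `⊤`, that vanish at `⊤` and are continuous
along increasing sequences. -/
structure IsMonoContValuation (V : (E → EReal) → ℝ) : Prop where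
  map_top : V ⊤ = 0
  map_sup_add_map_inf : ∀ u v, IsClosedConvex u → IsClosedConvex v → IsClosedConvex (u ⊓ v) →
    V (u ⊔ v) + V (u ⊓ v) = V u + V v
  tendsto : ∀ w : ℕ → E → EReal, (∀ j, IsClosedConvex (w j)) → Monotone w →
    Tendsto (fun j => V (w j)) atTop (𝓝 (V (⨆ j, w j)))

/-- The part of `V` that lives strictly below all affine functions in the list. -/
noncomputable def cutBelow (V : (E → EReal) → ℝ) : List ((E →L[ℝ] ℝ) × ℝ) → (E → EReal) → ℝ
  | [], u => V u
  | a :: L, u => cutBelow V L u - cutBelow V L (u ⊔ affineFun a)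

namespace IsMonoContValuation

variable {V : (E → EReal) → ℝ}

/-- Joining with `f` commutes with `⊔`, `⊓` and suprema of sequences, so the difference inherits all
three properties. -/
lemma sub_sup (hV : IsMonoContValuation V) {f : E → EReal} (hf : IsClosedConvex f) :
    IsMonoContValuation fun u => V u - V (u ⊔ f) where
  map_top := by simp
  map_sup_add_map_inf u v hu hv huv := by
    have h1 := hV.map_sup_add_map_inf u v hu hv huv
    have h2 := hV.map_sup_add_map_inf (u ⊔ f) (v ⊔ f) (hu.sup hf) (hv.sup hf)
      (by rw [← sup_inf_right]; exact huv.sup hf)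
    rw [← sup_inf_right, ← sup_sup_distrib_right] at h2
    linarith
  tendsto w hw hmono := by
    refine (hV.tendsto w hw hmono).sub ?_
    rw [iSup_sup]
    exact hV.tendsto _ (fun j => (hw j).sup hf) fun i j hij => sup_le_sup_right (hmono hij) _

lemma cutBelow (hV : IsMonoContValuation V) : ∀ L, IsMonoContValuation (cutBelow V L)
  | [] => hV
  | a :: L => (hV.cutBelow L).sub_sup (isClosedConvex_affineFun a)

lemma cutBelow_eq_zero_of_mem_convexHull (hV : IsMonoContValuation V)
    (L : List ((E →L[ℝ] ℝ) × ℝ)) {u : E → EReal} (hu : IsClosedConvex u)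
    {b : (E →L[ℝ] ℝ) × ℝ} (hb : b ∈ convexHull ℝ {a | a ∈ L}) (hbu : affineFun b ≤ u) :
    _root_.cutBelow V L u = 0 := by
  induction L generalizing u b with
  | nil => simp at hb
  | cons a L ih =>
    rw [_root_.cutBelow, sub_eq_zero]
    rcases L.eq_nil_or_concat with rfl | hL
    · obtain rfl : b = a := by simpa using hb
      rw [sup_eq_left.2 hbu]
    · have hne : {c | c ∈ L}.Nonempty := by
        obtain ⟨M, c, rfl⟩ := hL
        exact ⟨c, by simp⟩
      have hcons : {c | c ∈ a :: L} = insert a {c | c ∈ L} := by ext; simp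
      rw [hcons, convexHull_insert hne, mem_convexJoin] at hb
      obtain ⟨a', ha', b', hb', hseg⟩ := hb
      obtain rfl : a' = a := ha'
      -- This writes `u` as the minimum of its joins with `a'` and `b'`. By induction `cutBelow V L`
      -- vanishes at the second join and at the maximum of the two, so it agrees at `u` and at the
      -- first join.
      have hinf : (u ⊔ affineFun a') ⊓ (u ⊔ affineFun b') = u := by
        rw [← sup_inf_left, sup_eq_left]
        exact (affineFun_inf_le_of_mem_segment hseg).trans hbu
      have ha := hu.sup (isClosedConvex_affineFun a')
      have hb := hu.sup (isClosedConvex_affineFun b')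
      have key := (hV.cutBelow L).map_sup_add_map_inf _ _ ha hb (by rwa [hinf])
      rw [hinf, ih hb hb' le_sup_right, ih (ha.sup hb) hb' (le_sup_right.trans le_sup_right)] at key
      linarith

lemma cutBelow_eq_zero (hV : IsMonoContValuation V) (L : List ((E →L[ℝ] ℝ) × ℝ))
    {u : E → EReal} (hu : IsClosedConvex u)
    (h : ∀ x (t : ℝ), u x ≤ t → ∃ a ∈ L, affineFun a x ≤ t) : _root_.cutBelow V L u = 0 := by
  by_cases htop : u = ⊤
  · rw [htop, (hV.cutBelow L).map_top]
  · obtain ⟨b, hb, hbu⟩ := hu.exists_mem_convexHull_affineFun_le htop L.finite_toSet h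
    exact hV.cutBelow_eq_zero_of_mem_convexHull L hu hb hbu

/-- Linear relations between the indicator functions of epigraphs on the region strictly below
finitely many affine functions carry over to the corresponding part of a valuation. -/
theorem sum_mul_cutBelow_eq_zero [SecondCountableTopology E] (hV : IsMonoContValuation V)
    {ι : Type*} (s : Finset ι) (α : ι → ℝ) (L : List ((E →L[ℝ] ℝ) × ℝ)) (u : ι → E → EReal)
    (hu : ∀ i, IsClosedConvex (u i))
    (h : ∀ p : E × ℝ, (∀ a ∈ L, (p.2 : EReal) < affineFun a p.1) →
      ∑ i ∈ s, α i * epiIndicator (u i) p = 0) :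
    ∑ i ∈ s, α i * _root_.cutBelow V L (u i) = 0 := by
  classical
  -- Dropping a member costs one more affine function in `L`, and joins change the family; hence the
  -- generalization.
  induction s using Finset.strongInduction generalizing L u with
  | H s ih =>
  have rel_sup : ∀ {v : ι → E → EReal} (f : E → EReal),
      (∀ p : E × ℝ, (∀ a ∈ L, (p.2 : EReal) < affineFun a p.1) →
        ∑ i ∈ s, α i * epiIndicator (v i) p = 0) →
      ∀ p : E × ℝ, (∀ a ∈ L, (p.2 : EReal) < affineFun a p.1) →
        ∑ i ∈ s, α i * epiIndicator (v i ⊔ f) p = 0 := by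
    intro v f hv p hp
    simp only [epiIndicator_sup, ← mul_assoc, ← Finset.sum_mul, hv p hp, zero_mul]
  -- Below `a ≤ v i₀` the indicator of `v i₀` is zero, so the hypothesis for `s.erase i₀` applies
  -- with `a :: L`; the recursion for `cutBelow` turns its conclusion into this equality.
  have sup_affine : ∀ (a : (E →L[ℝ] ℝ) × ℝ), ∀ i₀ ∈ s, ∀ v : ι → E → EReal,
      (∀ i, IsClosedConvex (v i)) →
      (∀ p : E × ℝ, (∀ a ∈ L, (p.2 : EReal) < affineFun a p.1) →
        ∑ i ∈ s, α i * epiIndicator (v i) p = 0) → affineFun a ≤ v i₀ →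
      ∑ i ∈ s, α i * _root_.cutBelow V L (v i) =
        ∑ i ∈ s, α i * _root_.cutBelow V L (v i ⊔ affineFun a) := by
    intro a i₀ hi₀ v hv hrel hle
    have key := ih (s.erase i₀) (Finset.erase_ssubset hi₀) (a :: L) v hv fun p hp => by
      have h1 := hrel p fun a ha => hp a (List.mem_cons_of_mem _ ha)
      rw [← Finset.add_sum_erase s _ hi₀] at h1
      have h2 : epiIndicator (v i₀) p = 0 :=
        if_neg (not_le.2 ((hp a List.mem_cons_self).trans_le (hle _)))
      rwa [h2, mul_zero, zero_add] at h1
    rw [← sub_eq_zero, ← Finset.sum_sub_distrib, ← Finset.add_sum_erase s _ hi₀,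
      sup_eq_left.2 hle, sub_self, zero_add, ← key]
    exact Finset.sum_congr rfl fun i _ => (mul_sub _ _ _).symm
  -- The minorants of `v i₀` are joined one at a time, keeping the sum constant; continuity along
  -- their partial suprema gives the limit.
  have sup_member : ∀ i₀ ∈ s, ∀ v : ι → E → EReal, (∀ i, IsClosedConvex (v i)) →
      (∀ p : E × ℝ, (∀ a ∈ L, (p.2 : EReal) < affineFun a p.1) →
        ∑ i ∈ s, α i * epiIndicator (v i) p = 0) →
      ∑ i ∈ s, α i * _root_.cutBelow V L (v i) =
        ∑ i ∈ s, α i * _root_.cutBelow V L (v i ⊔ v i₀) := by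
    intro i₀ hi₀ v hv hrel
    obtain ⟨a, ha⟩ := (hv i₀).exists_seq_affineFun
    have hle : ∀ j, affineFun (a j) ≤ v i₀ := fun j => ha ▸ le_iSup (fun j => affineFun (a j)) j
    let g := partialSups fun j => affineFun (a j)
    have hg : ∀ j, IsClosedConvex (g j) := by
      intro j
      induction j with
      | zero => simpa [g] using isClosedConvex_affineFun (a 0)
      | succ j hj =>
        simp only [g, partialSups_add_one]
        exact hj.sup (isClosedConvex_affineFun _)
    have hgle : ∀ j, g j ≤ v i₀ := fun j => partialSups_le _ _ _ fun i _ => hle i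
    have hconst : ∀ j, ∑ i ∈ s, α i * _root_.cutBelow V L (v i) =
        ∑ i ∈ s, α i * _root_.cutBelow V L (v i ⊔ g j) := by
      intro j
      induction j with
      | zero => simpa [g] using sup_affine (a 0) i₀ hi₀ v hv hrel (hle 0)
      | succ j hj =>
        rw [hj, sup_affine (a (j + 1)) i₀ hi₀ _ (fun i => (hv i).sup (hg j)) (rel_sup _ hrel)
          ((hle _).trans le_sup_left)]
        simp only [g, partialSups_add_one, sup_assoc]
    have hlim : ∀ i, Tendsto (fun j => _root_.cutBelow V L (v i ⊔ g j)) atTop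
        (𝓝 (_root_.cutBelow V L (v i ⊔ v i₀))) := by
      intro i
      have h1 := (hV.cutBelow L).tendsto (fun j => v i ⊔ g j) (fun j => (hv i).sup (hg j))
        fun j k hjk => sup_le_sup_left (g.mono hjk) _
      rwa [← sup_iSup, iSup_partialSups_eq, ha] at h1
    have hlim' := tendsto_finsetSum s fun i _ => (hlim i).const_mul (α i)
    simp only [← hconst] at hlim'
    exact tendsto_nhds_unique tendsto_const_nhds hlim'
  rcases s.eq_empty_or_nonempty with rfl | hs
  · simp
  have sup_subset : ∀ r : Finset ι, r ⊆ s → r.Nonempty →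
      ∑ i ∈ s, α i * _root_.cutBelow V L (u i) =
        ∑ i ∈ s, α i * _root_.cutBelow V L (u i ⊔ r.sup u) := by
    intro r hr hne
    induction hne using Finset.Nonempty.cons_induction with
    | singleton i => simpa using sup_member i (hr (by simp)) u hu h
    | cons i r hi hne hrec =>
      rw [hrec fun j hj => hr (Finset.mem_cons_of_mem hj),
        sup_member i (hr (Finset.mem_cons_self _ _)) _
          (fun j => (hu j).sup (IsClosedConvex.finset_sup hu hne)) (rel_sup _ h)]
      refine Finset.sum_congr rfl fun j _ => ?_
      rw [Finset.sup_cons, ← sup_sup_distrib_right, sup_assoc]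
  rw [sup_subset s subset_rfl hs]
  have hmax : ∀ i ∈ s, u i ⊔ s.sup u = s.sup u := fun i hi => sup_eq_right.2 (Finset.le_sup hi)
  rw [Finset.sum_congr rfl fun i hi => by rw [hmax i hi], ← Finset.sum_mul]
  -- On the epigraph of the maximum every indicator is 1, so a nonzero coefficient sum leaves no
  -- such point below all of `L`.
  by_cases hα : ∑ i ∈ s, α i = 0
  · rw [hα, zero_mul]
  · rw [hV.cutBelow_eq_zero L (IsClosedConvex.finset_sup hu hs), mul_zero]
    intro x t hxt
    by_contra! hlt
    refine hα ?_
    rw [← h (x, t) hlt]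
    refine Finset.sum_congr rfl fun i hi => ?_
    rw [epiIndicator, if_pos ((Finset.le_sup (f := u) hi x).trans hxt), mul_one]

theorem sum_mul_eq_zero [SecondCountableTopology E] (hV : IsMonoContValuation V)
    {ι : Type*} (s : Finset ι) (α : ι → ℝ) (u : ι → E → EReal) (hu : ∀ i, IsClosedConvex (u i))
    (h : ∀ p, ∑ i ∈ s, α i * epiIndicator (u i) p = 0) : ∑ i ∈ s, α i * V (u i) = 0 :=
  hV.sum_mul_cutBelow_eq_zero s α [] u hu fun p _ => h p

end IsMonoContValuation

end Valuation

/-! ### Truncation to a ball and a sublevel set. -/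

section Truncation

open Classical in
/-- The restriction of `u` to the ball of radius `k` and to the sublevel set at height `k`. -/
noncomputable def truncate {E : Type*} [Norm E] (k : ℕ) (u : E → EReal) (x : E) : EReal :=
  if ‖x‖ ≤ k ∧ u x ≤ ((k : ℝ) : EReal) then u x else ⊤

section

variable {E : Type*} [Norm E]

lemma truncate_le_iff {k : ℕ} {u : E → EReal} {x : E} {t : EReal} (ht : t ≠ ⊤) :
    truncate k u x ≤ t ↔ ‖x‖ ≤ k ∧ u x ≤ ((k : ℝ) : EReal) ∧ u x ≤ t := by
  unfold truncate
  split_ifs with h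
  · exact ⟨fun h' => ⟨h.1, h.2, h'⟩, fun h' => h'.2.2⟩
  · simp only [top_le_iff, ht, false_iff]
    tauto

lemma le_truncate (k : ℕ) (u : E → EReal) : u ≤ truncate k u := by
  intro x
  unfold truncate
  split_ifs <;> simp

lemma truncate_top (k : ℕ) : truncate k (⊤ : E → EReal) = ⊤ := by
  ext x
  simp [truncate]

lemma truncate_sup (k : ℕ) (u v : E → EReal) :
    truncate k (u ⊔ v) = truncate k u ⊔ truncate k v := by
  ext x
  simp only [truncate, Pi.sup_apply, sup_le_iff]
  by_cases hu : u x ≤ ((k : ℝ) : EReal) <;> by_cases hv : v x ≤ ((k : ℝ) : EReal) <;>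
    by_cases hx : ‖x‖ ≤ k <;>
    simp only [hu, hv, hx, and_true, and_false, if_true, if_false, top_sup_eq, sup_top_eq]

lemma truncate_inf (k : ℕ) (u v : E → EReal) :
    truncate k (u ⊓ v) = truncate k u ⊓ truncate k v := by
  ext x
  simp only [truncate, Pi.inf_apply, inf_le_iff]
  by_cases hu : u x ≤ ((k : ℝ) : EReal) <;> by_cases hv : v x ≤ ((k : ℝ) : EReal) <;>
    by_cases hx : ‖x‖ ≤ k <;>
    simp only [hu, hv, hx, and_true, and_false, or_true, true_or, or_self, if_true, if_false,
      top_inf_eq, inf_top_eq]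
  · exact inf_eq_left.2 (hu.trans (not_le.1 hv).le)
  · exact inf_eq_right.2 (hv.trans (not_le.1 hu).le)

lemma truncate_mono (k : ℕ) : Monotone (truncate k : (E → EReal) → E → EReal) := by
  intro u v huv
  rw [← sup_eq_right, ← truncate_sup, sup_eq_right.2 huv]

lemma truncate_iSup (k : ℕ) {ι : Type*} [Nonempty ι] (u : ι → E → EReal) :
    truncate k (⨆ i, u i) = ⨆ i, truncate k (u i) := by
  refine le_antisymm (fun x => ?_) (iSup_le fun i => truncate_mono k (le_iSup u i))
  by_cases h : (⨆ i, truncate k (u i)) x = ⊤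
  · rw [h]; exact le_top
  · rw [truncate_le_iff h]
    have hne : ∀ i, truncate k (u i) x ≠ ⊤ := fun i hi => h <| top_le_iff.1 <| by
      rw [iSup_apply, ← hi]
      exact le_iSup (fun i => truncate k (u i) x) i
    have key := fun i => (truncate_le_iff (hne i)).1 le_rfl
    simp only [iSup_apply]
    exact ⟨(key (Classical.arbitrary ι)).1, iSup_le fun i => (key i).2.1,
      iSup_mono fun i => (key i).2.2⟩

lemma eventually_truncate_eq (u : E → EReal) (x : E) : ∀ᶠ k in atTop, truncate k u x = u x := by
  by_cases hx : u x = ⊤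
  · exact Eventually.of_forall fun k => top_le_iff.1 (hx ▸ le_truncate k u x) |>.trans hx.symm
  · obtain ⟨k₀, hk₀⟩ := exists_nat_ge (max ‖x‖ (u x).toReal)
    filter_upwards [eventually_ge_atTop k₀] with k hk
    have hk' : max ‖x‖ (u x).toReal ≤ k := hk₀.trans (by exact_mod_cast hk)
    refine if_pos ⟨(le_max_left _ _).trans hk', (EReal.le_coe_toReal hx).trans ?_⟩
    exact_mod_cast (le_max_right _ _).trans hk'

end

variable {E : Type*} [NormedAddCommGroup E] [NormedSpace ℝ E]

lemma IsClosedConvex.truncate {u : E → EReal} (hu : IsClosedConvex u) (k : ℕ) :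
    IsClosedConvex (truncate k u) where
  ne_bot x hx := hu.ne_bot x (le_bot_iff.1 (hx ▸ le_truncate k u x))
  convex := by
    have h1 : Convex ℝ {p : E × ℝ | ‖p.1‖ ≤ k} := by
      rw [show {p : E × ℝ | ‖p.1‖ ≤ k} = LinearMap.fst ℝ E ℝ ⁻¹' Metric.closedBall 0 k by
        ext p; simp]
      exact (convex_closedBall (0 : E) (k : ℝ)).linear_preimage (LinearMap.fst ℝ E ℝ)
    have h2 : Convex ℝ {p : E × ℝ | u p.1 ≤ ((k : ℝ) : EReal)} := by
      intro p hp q hq a b ha hb hab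
      have := hu.convex (x := (p.1, (k : ℝ))) hp (y := (q.1, (k : ℝ))) hq ha hb hab
      simp only [Set.mem_ofPred_eq, Prod.fst_add, Prod.snd_add, Prod.smul_fst, Prod.smul_snd,
        smul_eq_mul, ← add_mul, hab, one_mul] at this
      exact this
    convert h1.inter (h2.inter hu.convex) using 1
    ext p
    exact truncate_le_iff (EReal.coe_ne_top _)
  lsc := by
    rw [lowerSemicontinuous_iff_isClosed_preimage]
    intro t
    by_cases ht : t = ⊤
    · simp [ht]
    · have h1 : IsClosed {x : E | ‖x‖ ≤ k} := isClosed_le continuous_norm continuous_const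
      convert h1.inter ((hu.lsc.isClosed_preimage ((k : ℝ) : EReal)).inter
        (hu.lsc.isClosed_preimage t)) using 1
      ext x
      exact truncate_le_iff ht

/-- If an increasing sequence of truncated functions converges to `⊤`, then it is eventually
equal to `⊤`. -/
lemma eventually_truncate_eq_top [ProperSpace E] (k : ℕ) {w : ℕ → E → EReal}
    (hw : ∀ j, IsClosedConvex (w j)) (hmono : Monotone w) (htop : truncate k (⨆ j, w j) = ⊤) :
    ∀ᶠ j in atTop, truncate k (w j) = ⊤ := by
  -- A value of the truncation is `⊤` or at most `k`, so `K j` is its whole effective domain.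
  -- Cantor's intersection theorem makes some `K j` empty.
  let K : ℕ → Set E := fun j => {x | truncate k (w j) x ≤ ((k : ℝ) : EReal)}
  have hKc : ∀ j, IsClosed (K j) := fun j => ((hw j).truncate k).lsc.isClosed_preimage _
  have hanti : ∀ {i j}, i ≤ j → K j ⊆ K i := fun hij x hx =>
    (truncate_mono k (hmono hij) x).trans hx
  have hiff : ∀ j, K j = ∅ → truncate k (w j) = ⊤ := by
    intro j hj
    ext x
    refine if_neg fun h => ?_
    have : x ∈ K j := (truncate_le_iff (EReal.coe_ne_top _)).2 ⟨h.1, h.2, h.2⟩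
    simp [hj] at this
  obtain ⟨j, hj⟩ : ∃ j, K j = ∅ := by
    by_contra! hne
    have hcomp : IsCompact (K 0) :=
      (isCompact_closedBall (0 : E) (k : ℝ)).of_isClosed_subset (hKc 0) fun x hx => by
        simpa using ((truncate_le_iff (EReal.coe_ne_top _)).1 hx).1
    obtain ⟨x, hx⟩ := IsCompact.nonempty_iInter_of_sequence_nonempty_isCompact_isClosed K
      (fun j => hanti j.le_succ) hne hcomp hKc
    rw [Set.mem_iInter] at hx
    have h1 : truncate k (⨆ j, w j) x ≤ ((k : ℝ) : EReal) := by
      rw [truncate_iSup, iSup_apply]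
      exact iSup_le hx
    rw [htop] at h1
    exact EReal.coe_ne_top _ (top_le_iff.1 h1)
  filter_upwards [eventually_ge_atTop j] with i hi
  exact hiff i (Set.subset_eq_empty (hanti hi) hj)

end Truncation

/-! ### From continuous valuations to linear functionals. -/

section ConvValuation

variable {n : ℕ}

lemma IsConv.isClosedConvex {u : EuclideanSpace ℝ (Fin n) → EReal} (hu : IsConv u) :
    IsClosedConvex u :=
  ⟨hu.1, hu.2.1, hu.2.2.1⟩

lemma IsClosedConvex.isConv {u : EuclideanSpace ℝ (Fin n) → EReal} (hu : IsClosedConvex u)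
    (h : u ≠ ⊤) : IsConv u :=
  ⟨hu.ne_bot, hu.convex, hu.lsc, by
    by_contra! hx
    exact h (funext hx)⟩

lemma IsConv.ne_top {u : EuclideanSpace ℝ (Fin n) → EReal} (hu : IsConv u) : u ≠ ⊤ := by
  rintro rfl
  obtain ⟨x, hx⟩ := hu.2.2.2
  exact hx rfl

lemma valueOrZero_top (Z : Conv n → ℝ) : valueOrZero Z ⊤ = 0 :=
  dif_neg fun h => h.ne_top rfl

lemma valueOrZero_of_isConv (Z : Conv n → ℝ) {u : EuclideanSpace ℝ (Fin n) → EReal}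
    (hu : IsConv u) : valueOrZero Z u = Z ⟨u, hu⟩ :=
  dif_pos hu

/-- By connectedness of epigraphs, `u ∨ v ≡ +∞` is only possible for convex `u ∧ v` if `u` or `v`
is `≡ +∞`. -/
lemma eq_top_or_eq_top_of_sup_eq_top {E : Type*} [NormedAddCommGroup E] [NormedSpace ℝ E]
    {u v : E → EReal} (hu : IsClosedConvex u)
    (hv : IsClosedConvex v) (huv : IsClosedConvex (u ⊓ v)) (h : u ⊔ v = ⊤) : u = ⊤ ∨ v = ⊤ := by
  by_contra! hne
  have hex : ∀ {w : E → EReal}, w ≠ ⊤ →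
      ({p : E × ℝ | w p.1 ≤ (p.2 : EReal)}).Nonempty := by
    intro w hw
    by_contra! hempty
    refine hw (funext fun x => by_contra fun hx => ?_)
    have : (x, (w x).toReal) ∈ {p : E × ℝ | w p.1 ≤ (p.2 : EReal)} :=
      EReal.le_coe_toReal hx
    simp [hempty] at this
  have hpre := isPreconnected_closed_iff.1 huv.convex.isPreconnected _ _ hu.isClosed_epigraph
    hv.isClosed_epigraph (fun p hp => by simpa using hp)
  obtain ⟨p, hp⟩ := hex hne.1
  obtain ⟨q, hq⟩ := hex hne.2
  obtain ⟨z, -, hz1, hz2⟩ := hpre ⟨p, inf_le_left.trans (a := (u ⊓ v) p.1) hp, hp⟩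
    ⟨q, inf_le_right.trans (a := (u ⊓ v) q.1) hq, hq⟩
  have : (u ⊔ v) z.1 ≤ (z.2 : EReal) := sup_le hz1 hz2
  rw [h] at this
  simp at this

/-- The value 0 at `⊤` is consistent: disjoint nonempty domains cannot occur when the minimum is
convex. -/
lemma IsConvValuation.valueOrZero_sup_add_inf {Z : Conv n → ℝ} (hval : IsConvValuation Z)
    {u v : EuclideanSpace ℝ (Fin n) → EReal} (hu : IsClosedConvex u) (hv : IsClosedConvex v)
    (huv : IsClosedConvex (u ⊓ v)) :
    valueOrZero Z (u ⊔ v) + valueOrZero Z (u ⊓ v) = valueOrZero Z u + valueOrZero Z v := by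
  by_cases hu' : u = ⊤
  · simp [hu']
  by_cases hv' : v = ⊤
  · simp [hv', add_comm]
  have hsup : u ⊔ v ≠ ⊤ := fun h =>
    (eq_top_or_eq_top_of_sup_eq_top hu hv huv h).elim hu' hv'
  have hinf : u ⊓ v ≠ ⊤ := fun h => hu' (inf_eq_top_iff.1 h).1
  rw [valueOrZero_of_isConv Z (hu.isConv hu'), valueOrZero_of_isConv Z (hv.isConv hv'),
    valueOrZero_of_isConv Z ((hu.sup hv).isConv hsup), valueOrZero_of_isConv Z (huv.isConv hinf)]
  exact hval _ _ _ _ rfl rfl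

lemma EpiConverges.tendsto {u : ℕ → Conv n} {v : Conv n} (h : EpiConverges u v) :
    Tendsto u atTop (𝓝 v) :=
  tendsto_nhds.2 fun _ hU hv => hU u v h hv

/-- For the liminf bound, lower semicontinuity of one `w j` with a large value at `x` suffices;
monotonicity passes it on to later indices. -/
lemma epiConverges_of_monotone {w : ℕ → Conv n} {v : Conv n} (hmono : Monotone fun j => (w j).toFun)
    (hv : v.toFun = ⨆ j, (w j).toFun) : EpiConverges w v := by
  refine fun x => ⟨fun y hy => ?_, fun _ => x, tendsto_const_nhds, ?_⟩
  · refine le_of_forall_lt fun a ha => ?_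
    obtain ⟨b, hab, hb⟩ := exists_between ha
    rw [hv, iSup_apply, lt_iSup_iff] at hb
    obtain ⟨j, hj⟩ := hb
    refine hab.trans_le (le_liminf_of_le (by isBoundedDefault) ?_)
    filter_upwards [hy.eventually ((w j).isConv.2.2.1 x b hj), eventually_ge_atTop j] with k hk hjk
    exact hk.le.trans (hmono hjk _)
  · rw [hv, iSup_apply]
    exact tendsto_atTop_iSup fun i j hij => hmono hij x

lemma epiConverges_of_le_of_eventually_eq {w : ℕ → Conv n} {v : Conv n}
    (hle : ∀ᶠ k in atTop, v.toFun ≤ (w k).toFun)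
    (heq : ∀ x, ∀ᶠ k in atTop, (w k).toFun x = v.toFun x) : EpiConverges w v := by
  refine fun x => ⟨fun y hy => ?_, fun _ => x, tendsto_const_nhds,
    tendsto_const_nhds.congr' ((heq x).mono fun k hk => hk.symm)⟩
  refine le_of_forall_lt fun a ha => ?_
  obtain ⟨b, hab, hb⟩ := exists_between ha
  refine hab.trans_le (le_liminf_of_le (by isBoundedDefault) ?_)
  filter_upwards [hy.eventually (v.isConv.2.2.1 x b hb), hle] with k hk hk'
  exact hk.le.trans (hk' _)

/-- Continuity of `Z` says nothing about sequences increasing to `⊤`; after truncation these are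
eventually `⊤`. -/
lemma isMonoContValuation_truncate {Z : Conv n → ℝ} (hcont : Continuous Z)
    (hval : IsConvValuation Z) (k : ℕ) :
    IsMonoContValuation fun u => valueOrZero Z (truncate k u) where
  map_top := by rw [truncate_top, valueOrZero_top]
  map_sup_add_map_inf u v hu hv huv := by
    rw [truncate_sup, truncate_inf]
    refine hval.valueOrZero_sup_add_inf (hu.truncate k) (hv.truncate k) ?_
    rw [← truncate_inf]
    exact huv.truncate k
  tendsto w hw hmono := by
    by_cases htop : truncate k (⨆ j, w j) = ⊤
    · rw [htop, valueOrZero_top]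
      refine tendsto_const_nhds.congr' ?_
      filter_upwards [eventually_truncate_eq_top k hw hmono htop] with j hj
      rw [hj, valueOrZero_top]
    · have hconv : ∀ j, IsConv (truncate k (w j)) := fun j =>
        ((hw j).truncate k).isConv fun hj =>
          htop (top_le_iff.1 (hj ▸ truncate_mono k (le_iSup w j)))
      have hlim := ((IsClosedConvex.iSup hw).truncate k).isConv htop
      simp only [valueOrZero_of_isConv Z (hconv _), valueOrZero_of_isConv Z hlim]
      refine (hcont.tendsto _).comp (EpiConverges.tendsto (epiConverges_of_monotone ?_ ?_))
      · exact fun i j hij => truncate_mono k (hmono hij)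
      · exact truncate_iSup k w

lemma tendsto_valueOrZero_truncate {Z : Conv n → ℝ} (hcont : Continuous Z)
    {u : EuclideanSpace ℝ (Fin n) → EReal} (hu : IsClosedConvex u) :
    Tendsto (fun k => valueOrZero Z (truncate k u)) atTop (𝓝 (valueOrZero Z u)) := by
  classical
  by_cases htop : u = ⊤
  · simp [htop, truncate_top]
  have hconv := hu.isConv htop
  obtain ⟨x, hx⟩ := hconv.2.2.2
  have hev : ∀ᶠ k in atTop, IsConv (truncate k u) := by
    filter_upwards [eventually_truncate_eq u x] with k hk
    exact (hu.truncate k).isConv fun h => hx (by rw [← hk, h]; rfl)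
  -- The default `u` is used only at the finitely many levels where the truncation is `⊤`.
  let w : ℕ → Conv n := fun k => if h : IsConv (truncate k u) then ⟨_, h⟩ else ⟨u, hconv⟩
  have hw : ∀ᶠ k in atTop, (w k).toFun = truncate k u := hev.mono fun k hk => by
    simp only [w, dif_pos hk]
  have hepi : EpiConverges w ⟨u, hconv⟩ := by
    refine epiConverges_of_le_of_eventually_eq ?_ fun x => ?_
    · filter_upwards [hw] with k hk
      rw [hk]
      exact le_truncate k u
    · filter_upwards [hw, eventually_truncate_eq u x] with k hk hk'
      rw [hk, hk']
  rw [valueOrZero_of_isConv Z hconv]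
  refine ((hcont.tendsto _).comp hepi.tendsto).congr' ?_
  filter_upwards [hev] with k hk
  rw [valueOrZero_of_isConv Z hk]
  simp only [Function.comp_apply, w, dif_pos hk]

theorem sum_mul_valueOrZero_eq_zero {Z : Conv n → ℝ} (hcont : Continuous Z)
    (hval : IsConvValuation Z) {ι : Type*} (s : Finset ι) (α : ι → ℝ)
    (u : ι → EuclideanSpace ℝ (Fin n) → EReal) (hu : ∀ i, IsClosedConvex (u i))
    (h : ∀ p, ∑ i ∈ s, α i * epiIndicator (u i) p = 0) :
    ∑ i ∈ s, α i * valueOrZero Z (u i) = 0 := by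
  have hlim := tendsto_finsetSum s fun i _ =>
    (tendsto_valueOrZero_truncate hcont (hu i)).const_mul (α i)
  simp only [(isMonoContValuation_truncate hcont hval _).sum_mul_eq_zero s α u hu h] at hlim
  exact tendsto_nhds_unique hlim tendsto_const_nhds

/-- A continuous valuation on `Conv(ℝⁿ)` is the restriction of a linear functional, if functions
are identified with the indicator functions of their epigraphs. -/
theorem exists_linearMap_epiIndicator {Z : Conv n → ℝ} (hcont : Continuous Z)
    (hval : IsConvValuation Z) :
    ∃ Φ : (EuclideanSpace ℝ (Fin n) × ℝ → ℝ) →ₗ[ℝ] ℝ,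
      ∀ u, IsClosedConvex u → Φ (epiIndicator u) = valueOrZero Z u := by
  let C := {u : EuclideanSpace ℝ (Fin n) → EReal // IsClosedConvex u}
  let F := Finsupp.linearCombination ℝ fun u : C => epiIndicator u.1
  let G := Finsupp.linearCombination ℝ fun u : C => valueOrZero Z u.1
  have hker : LinearMap.ker F ≤ LinearMap.ker G := by
    intro α hα
    rw [LinearMap.mem_ker, Finsupp.linearCombination_apply, Finsupp.sum] at hα ⊢
    refine sum_mul_valueOrZero_eq_zero hcont hval α.support α (fun u : C => u.1)
      (fun u => u.2) fun p => ?_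
    simpa using congrFun hα p
  -- `G` factors through the range of `F` by `hker`; a linear section of `F` realizes the
  -- factorization, which then extends to all functions.
  obtain ⟨s, hs⟩ := F.rangeRestrict.exists_rightInverse_of_surjective F.range_rangeRestrict
  obtain ⟨Φ, hΦ⟩ := (G ∘ₗ s).exists_extend
  refine ⟨Φ, fun u hu => ?_⟩
  let e : C →₀ ℝ := Finsupp.single ⟨u, hu⟩ 1
  have hFe : F e = epiIndicator u := by simp [F, e]
  have hGe : G e = valueOrZero Z u := by simp [G, e]
  have h1 : Φ (F e) = G (s (F.rangeRestrict e)) := LinearMap.congr_fun hΦ (F.rangeRestrict e)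
  have h2 : F (s (F.rangeRestrict e)) = F e :=
    congrArg Subtype.val (LinearMap.congr_fun hs (F.rangeRestrict e))
  rw [← hFe, h1, ← hGe, ← sub_eq_zero, ← map_sub]
  exact hker (by rw [LinearMap.mem_ker, map_sub, h2, sub_self])

end ConvValuation

/-! ### Inclusion–exclusion for epigraphs. -/

lemma epiIndicator_finset_sup {E ι : Type*} (s : Finset ι) (u : ι → E → EReal) (p : E × ℝ) :
    epiIndicator (s.sup u) p = ∏ i ∈ s, epiIndicator (u i) p := by
  classical
  induction s using Finset.induction_on with
  | empty => simp [epiIndicator]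
  | insert i s hi ih => rw [Finset.sup_insert, Finset.prod_insert hi, epiIndicator_sup, ih]

lemma one_sub_epiIndicator_finset_inf {E ι : Type*} (s : Finset ι) (u : ι → E → EReal)
    (p : E × ℝ) :
    1 - epiIndicator (s.inf u) p = ∏ i ∈ s, (1 - epiIndicator (u i) p) := by
  classical
  induction s using Finset.induction_on with
  | empty => simp [epiIndicator]
  | insert i s hi ih =>
    rw [Finset.inf_insert, Finset.prod_insert hi, ← ih]
    have h1 := epiIndicator_sup_add_inf (u i) (s.inf u) p
    rw [epiIndicator_sup] at h1
    linear_combination -h1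

/-- The inclusion-exclusion formula for indicator functions of epigraphs. -/
lemma epiIndicator_finset_inf {E ι : Type*} [Fintype ι] [DecidableEq ι] (u : ι → E → EReal) :
    epiIndicator (Finset.univ.inf u) =
      ∑ J ∈ (Finset.univ : Finset (Finset ι)) with J.Nonempty,
        (-1 : ℝ) ^ (J.card - 1) • epiIndicator (J.sup u) := by
  ext p
  have h1 := one_sub_epiIndicator_finset_inf Finset.univ u p
  simp only [sub_eq_add_neg (1 : ℝ) (epiIndicator (u _) p)] at h1
  -- Expanding the product gives a sum over all subsets; the empty one contributes the 1 that
  -- cancels on the left.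
  rw [Finset.prod_one_add, Finset.powerset_univ,
    ← Finset.sum_filter_add_sum_filter_not _ (fun J : Finset ι => J.Nonempty)] at h1
  have h2 : (Finset.univ.filter fun J : Finset ι => ¬J.Nonempty) = {∅} := by
    ext J; simp
  rw [h2, Finset.sum_singleton] at h1
  simp only [Finset.prod_neg, Finset.prod_empty, Finset.card_empty, pow_zero, mul_one] at h1
  rw [Finset.sum_apply]
  have h3 : ∑ J ∈ (Finset.univ : Finset (Finset ι)) with J.Nonempty,
      (-1 : ℝ) ^ J.card * ∏ i ∈ J, epiIndicator (u i) p =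
      -∑ J ∈ (Finset.univ : Finset (Finset ι)) with J.Nonempty,
        ((-1 : ℝ) ^ (J.card - 1) • epiIndicator (J.sup u)) p := by
    rw [← Finset.sum_neg_distrib]
    refine Finset.sum_congr rfl fun J hJ => ?_
    rw [Finset.mem_filter] at hJ
    obtain ⟨k, hk⟩ := Nat.exists_eq_add_of_lt hJ.2.card_pos
    rw [Pi.smul_apply, smul_eq_mul, epiIndicator_finset_sup, hk]
    simp only [zero_add, Nat.add_sub_cancel, pow_succ]
    ring
  linarith

/-! ### Uniqueness on the lattice of finite minima. -/

section MinLattice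

variable {n : ℕ}

/-- Every function in the lattice of finite minima is the minimum of a finite family. -/
lemma exists_eq_finset_inf {f : EuclideanSpace ℝ (Fin n) → EReal}
    (hf : f ∈ infClosure {u : EuclideanSpace ℝ (Fin n) → EReal | IsConv u}) :
    ∃ s : Finset (EuclideanSpace ℝ (Fin n) → EReal), (∀ u ∈ s, IsConv u) ∧ s.inf id = f := by
  obtain ⟨s, hs, hsub, rfl⟩ := hf
  exact ⟨s, fun u hu => hsub hu, (Finset.inf'_eq_inf hs id).symm⟩

lemma IsClosedConvex.mem_minLattice {u : EuclideanSpace ℝ (Fin n) → EReal}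
    (hu : IsClosedConvex u) : u ∈ minLattice n := by
  by_cases h : u = ⊤
  · exact Or.inl h
  · exact Or.inr (subset_infClosure (hu.isConv h))

lemma IsClosedConvex.finset_inf_mem_minLattice {ι : Type*} (s : Finset ι)
    {u : ι → EuclideanSpace ℝ (Fin n) → EReal} (hu : ∀ i ∈ s, IsClosedConvex (u i)) :
    s.inf u ∈ minLattice n := by
  classical
  induction s using Finset.induction_on with
  | empty => exact Or.inl rfl
  | insert i s hi ih =>
    rw [Finset.inf_insert]
    exact (minLattice n).infClosed' (hu i (by simp)).mem_minLattice
      (ih fun j hj => hu j (by simp [hj]))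

/-- A valuation on the lattice of finite minima is determined by its values on `Conv(ℝⁿ)`. -/
lemma IsMinLatticeValuation.ext {Y Y' : minLattice n → ℝ} (hY : IsMinLatticeValuation Y)
    (hY' : IsMinLatticeValuation Y') (h : ∀ u : Conv n, Y u.toMinLattice = Y' u.toMinLattice) :
    Y = Y' := by
  classical
  have hclosed : ∀ f : minLattice n, IsClosedConvex f.1 → Y f = Y' f := by
    rintro ⟨f, hf⟩ hfc
    by_cases htop : f = ⊤
    · subst htop
      exact hY.1.trans hY'.1.symm
    · exact h ⟨f, hfc.isConv htop⟩
  -- Indexed families keep the induction parameter fixed even if some joins `u i ⊔ u j` coincide.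
  have key : ∀ {ι : Type _} (s : Finset ι) (u : ι → EuclideanSpace ℝ (Fin n) → EReal),
      (∀ i ∈ s, IsClosedConvex (u i)) → ∀ f : minLattice n, f.1 = s.inf u → Y f = Y' f := by
    intro ι s
    induction s using Finset.induction_on with
    | empty => exact fun u _ f hf => hclosed f (hf ▸ IsClosedConvex.top)
    | insert i s hi ih =>
      intro u hu f hf
      have hui := hu i (by simp)
      have hus : ∀ j ∈ s, IsClosedConvex (u j) := fun j hj => hu j (by simp [hj])
      let a : minLattice n := ⟨u i, hui.mem_minLattice⟩
      let b : minLattice n := ⟨s.inf u, IsClosedConvex.finset_inf_mem_minLattice s hus⟩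
      have hab : f = a ⊓ b := Subtype.ext (hf.trans (Finset.inf_insert ..))
      -- By distributivity `a ⊔ b` is a minimum over `s` of closed convex functions, so the
      -- induction hypothesis covers it.
      have h1 := ih (fun j => u i ⊔ u j) (fun j hj => hui.sup (hus j hj)) (a ⊔ b)
        (Finset.inf_sup_distrib_left s u (u i))
      have h2 := ih u hus b rfl
      have h3 := hclosed a hui
      have h4 := hY.2 a b
      have h5 := hY'.2 a b
      rw [hab]
      linarith
  funext f
  rcases f.2 with hf | hf
  · exact hclosed f (hf ▸ IsClosedConvex.top)
  · obtain ⟨s, hs, hsf⟩ := exists_eq_finset_inf hf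
    exact key s id (fun u hu => (hs u hu).isClosedConvex) f hsf.symm

end MinLattice

/-! ### Extension and inclusion–exclusion for `Z`. -/

theorem theorem3p1 (n : ℕ) (Z : Conv n → ℝ) (hcont : Continuous Z) (hval : IsConvValuation Z) :
    (∃! Y : minLattice n → ℝ,
      IsMinLatticeValuation Y ∧ ∀ u : Conv n, Y u.toMinLattice = Z u) ∧
    (∀ (m : ℕ) (u : Fin m → Conv n) (w : Conv n),
      w.toFun = Finset.univ.inf (fun i => (u i).toFun) →
      Z w = ∑ J ∈ (Finset.univ : Finset (Finset (Fin m))) with J.Nonempty,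
        (-1 : ℝ) ^ (J.card - 1) * valueOrZero Z (J.sup fun j => (u j).toFun)) := by
  obtain ⟨Φ, hΦ⟩ := exists_linearMap_epiIndicator hcont hval
  have hΦZ : ∀ u : Conv n, Φ (epiIndicator u.toFun) = Z u := fun u =>
    (hΦ _ u.isConv.isClosedConvex).trans (valueOrZero_of_isConv Z u.isConv)
  refine ⟨⟨fun f => Φ (epiIndicator f.1), ⟨⟨?_, fun f g => ?_⟩, hΦZ⟩, ?_⟩, fun m u w hw => ?_⟩
  · exact (hΦ _ IsClosedConvex.top).trans (valueOrZero_top Z)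
  · rw [← map_add, ← map_add]
    exact congrArg Φ (funext fun p => epiIndicator_sup_add_inf f.1 g.1 p)
  · rintro Y ⟨hY, hYZ⟩
    refine hY.ext ⟨?_, fun f g => ?_⟩ fun u => (hYZ u).trans (hΦZ u).symm
    · exact (hΦ _ IsClosedConvex.top).trans (valueOrZero_top Z)
    · rw [← map_add, ← map_add]
      exact congrArg Φ (funext fun p => epiIndicator_sup_add_inf f.1 g.1 p)
  · rw [← hΦZ, hw, epiIndicator_finset_inf, map_sum]
    refine Finset.sum_congr rfl fun J hJ => ?_
    rw [map_smul, smul_eq_mul, hΦ _ (IsClosedConvex.finset_sup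
      (fun j => (u j).isConv.isClosedConvex) (Finset.mem_filter.1 hJ).2)]
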